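/- Let $\nu_p$ be the $p$-adic valuation on $\mathbb{Q}$ (with $\nu_p(0)=\infty$), let $\sigma_p(n)$ be the sum of the base $p$ digits of $n$, and for $l\in\mathbb{Z}$ let the higher order Bernoulli polynomials $B_n^{(l)}(x)\in\mathbb{Q}[x]$ be defined by $$\left(\frac{t}{e^t-1}\right)^{l}e^{tx}=\sum_{n\ge 0}\frac{B_n^{(l)}(x)}{n!}t^n,\qquad B_n^{(l)}=B_n^{(l)}(0).$$ The maximum pole of $f\in\mathbb{Q}[x]$ is the exponent of the highest power of $p$ occurring in the denominator of a coefficient of $f$, and $a\in\mathbb{Q}$ has a pole of order $M$ if $\nu_p(a)=-M$. We say that $B_n^{(l)}(x)$ is an almost maximum pole case (AMPC) if the order of the pole of $B_n^{(l)}$ is the maximum pole of $B_n^{(l)}(x)$, and that $B_n^{(l)}(x)$ is a shifted almost maximum pole case (SAMPC) if the order of the pole of $B_n^{(l+1)}(1)$ is the maximum pole of $B_n^{(l+1)}(x+1)$. For a partition $\mathbf{u}=(u_1,u_2,\dots)$ (natural numbers, eventually zero) put $w=\sum_i i u_i$, $d=\sum_i u_i$, and for $n \ge 0$ and $s\in\mathbb{Z}$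 put $$\tau_{\mathbf u}(s)=n(n-1)\cdots(n-w+1)\,\binom{s}{d}\binom{d}{u_1,u_2,\dots}\Big/\prod_i (i+1)^{u_i}.$$ Theorem. Let $p$ be an odd prime, $n\ge 0$ and $l$ integers, and assume that $r=n/(p-1)$ is an integer. Let $M$ be the maximum pole of $B_n^{(l)}(x)$ and $M'$ the maximum pole of $B_n^{(l+1)}(x)$, and let $\mathbf{u}$ be the partition with $u_{p-1}=r$ and $u_i=0$ for $i\ne p-1$. (a) $B_n^{(l-1)}(x)$ is a SAMPC if and only if $\nu_p\binom{l-n-1}{r}=\frac{\sigma_p(n)}{p-1}-M$, and also if and only if $\nu_p(\tau_{\mathbf u}(l-n-1))=-M=\nu_p(B_n^{(l)}(1))$. (b) Suppose $\nu_p(l)\le\nu_p(n)$. Then $B_n^{(l)}(x)$ is an AMPC if and only if $\nu_p(\tau_{\mathbf u}(l-n-1))=-M=\nu_p(B_n^{(l)})$, and also if and only if $\nu_p\binom{l-n-1}{r}=\frac{\sigma_p(n)}{p-1}-M$. Hence $B_n^{(l-1)}(x)$ is a SAMPC if and only if $B_n^{(l)}(x)$ is an AMPC, and if either holds then $\nu_p(B_n^{(l)})=\nu_p(B_n^{(l)}(1))$.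 (c) Suppose $\nu_p(l)>\nu_p(n)$. Then $\nu_p(l+1)\le\nu_p(n)$, and the conclusions of (b) hold with $l$ replaced by $l+1$ and $M$ by $M'$: $B_n^{(l+1)}(x)$ is an AMPC if and only if $\nu_p(\tau_{\mathbf u}(l-n))=-M'=\nu_p(B_n^{(l+1)})$, and also if and only if $\nu_p\binom{l-n}{r}=\frac{\sigma_p(n)}{p-1}-M'$; $B_n^{(l)}(x)$ is a SAMPC if and only if $B_n^{(l+1)}(x)$ is an AMPC, and if either holds then $\nu_p(B_n^{(l+1)})=\nu_p(B_n^{(l+1)}(1))$. -/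

import Mathlib

open scoped Nat

/-- The `p`-adic valuation of a rational number, with `ν_p(0) = ∞`. -/
noncomputable def nu (p : ℕ) (a : ℚ) : WithTop ℤ :=
  if a = 0 then ⊤ else ((padicValRat p a : ℤ) : WithTop ℤ)

/-- The sum `σ_p(n)` of the base `p` digits of `n`. -/
def digitSum (p n : ℕ) : ℕ := (Nat.digits p n).sum

/-- If `p - 1` divides `n`, it divides `σ_p(n)`, so that the quotient `σ_p(n) / (p - 1)` in `ℕ`
is exact. -/
theorem sub_one_dvd_digitSum {p n : ℕ} (hp : 3 ≤ p) (h : p - 1 ∣ n) : p - 1 ∣ digitSum p n := by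
  have h1 : p % (p - 1) = 1 := by
    obtain ⟨k, rfl⟩ : ∃ k, p = k + 3 := ⟨p - 3, by omega⟩
    rw [Nat.add_sub_assoc (by norm_num)]
    rw [show k + 3 = 1 + (k + (3 - 1)) by omega, Nat.add_mod_right]
    exact Nat.mod_eq_of_lt (by omega)
  exact ((Nat.modEq_digits_sum (p - 1) p h1 n).dvd_iff dvd_rfl).1 h

/-- The power series `(e^t - 1) / t = ∑ t^n / (n + 1)!`. -/
noncomputable def expSubOneDiv : PowerSeries ℚ :=
  PowerSeries.mk fun n => 1 / ((n + 1)! : ℚ)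

theorem X_mul_expSubOneDiv :
    (PowerSeries.X : PowerSeries ℚ) * expSubOneDiv = PowerSeries.exp ℚ - 1 := by
  ext n
  cases n with
  | zero => simp [PowerSeries.coeff_exp]
  | succ k =>
    simp [expSubOneDiv, PowerSeries.coeff_succ_X_mul, PowerSeries.coeff_one]

theorem isUnit_expSubOneDiv : IsUnit expSubOneDiv := by
  rw [PowerSeries.isUnit_iff_constantCoeff, ← PowerSeries.coeff_zero_eq_constantCoeff_apply]
  simp [expSubOneDiv]

/-- The power series `t / (e^t - 1)`, the inverse of `(e^t - 1) / t`, as a unit of `ℚ⟦t⟧`. -/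
noncomputable def todd : (PowerSeries ℚ)ˣ := isUnit_expSubOneDiv.unit⁻¹

/-- The higher order Bernoulli polynomial `B_n^{(l)}(x)` of order `l ∈ ℤ`:
`n!` times the coefficient of `t^n` in `(t / (e^t - 1))^l * e^{t x} ∈ ℚ[x]⟦t⟧`. -/
noncomputable def hoBernoulli (n : ℕ) (l : ℤ) : Polynomial ℚ :=
  (n ! : ℚ) • PowerSeries.coeff n
    (PowerSeries.map Polynomial.C ((todd ^ l : (PowerSeries ℚ)ˣ) : PowerSeries ℚ) *
      PowerSeries.rescale Polynomial.X (PowerSeries.exp (Polynomial ℚ)))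

/-- The maximum pole of a rational polynomial: the exponent of the highest power of `p` in the
denominator of any coefficient. -/
def maxPole (p : ℕ) (f : Polynomial ℚ) : ℕ :=
  f.support.sup fun i => padicValNat p (f.coeff i).den

/-- `a` has a pole of order `M`: `ν_p(a) = -M`. -/
def HasPole (p : ℕ) (a : ℚ) (M : ℕ) : Prop :=
  nu p a = ((-(M : ℤ) : ℤ) : WithTop ℤ)

/-- `B_n^{(l)}(x)` is an almost maximum pole case: the pole of the number
`B_n^{(l)} = B_n^{(l)}(0)` is the maximum pole of `B_n^{(l)}(x)`. -/
def IsAMPC (p n : ℕ) (l : ℤ) : Prop :=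
  HasPole p ((hoBernoulli n l).eval 0) (maxPole p (hoBernoulli n l))

/-- `B_n^{(l)}(x)` is a shifted almost maximum pole case: the pole of `B_n^{(l+1)}(1)` is the
maximum pole of `B_n^{(l+1)}(x + 1)`. -/
def IsSAMPC (p n : ℕ) (l : ℤ) : Prop :=
  HasPole p ((hoBernoulli n (l + 1)).eval 1)
    (maxPole p ((hoBernoulli n (l + 1)).comp (Polynomial.X + 1)))

/-- The weight `w(u) = ∑ i u_i` of a partition; `u i` is the multiplicity of the part `i ≥ 1`. -/
def partWeight (u : ℕ+ →₀ ℕ) : ℕ := u.sum fun i m => (i : ℕ) * m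

/-- The number `d(u) = ∑ u_i` of summands of a partition. -/
def partLength (u : ℕ+ →₀ ℕ) : ℕ := u.sum fun _ m => m

/-- `t_u(s) = C(s, d) * C(d; u_1, u_2, …) / Λ^u` where `Λ^u = 2^{u_1} 3^{u_2} ⋯`. -/
noncomputable def tPart (s : ℤ) (u : ℕ+ →₀ ℕ) : ℚ :=
  ((Ring.choose s (partLength u) : ℤ) : ℚ) * (u.multinomial : ℚ) /
    u.prod fun i m => (((i : ℕ) : ℚ) + 1) ^ m

/-- `τ_u(s) = (n)_w t_u(s)`, where `(n)_w = n (n - 1) ⋯ (n - w + 1)` and `w = w(u)`. -/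
noncomputable def tauPart (n : ℕ) (s : ℤ) (u : ℕ+ →₀ ℕ) : ℚ :=
  (n.descFactorial (partWeight u) : ℚ) * tPart s u

/-! Put z = e^t - 1, L = log(1+z)/z and s = l - n - 1. Lagrange inversion turns (t/(e^t-1))^l into
L^s: B_n^{(l)}(x+1) has coefficients (n)_w [z^w] L^s, w = n - k, on the falling factorials (x)_k,
while the values at 1 and 0 are n! [z^n] L^s and n! [z^n] L^s/(1+z). Falling factorials are monic
with integer coefficients, so the maximum pole M bounds the pole of each (n)_w [z^w] L^s.

For odd p, L = G + (z^{p-1}/p) E, where G has p-integral coefficients and E = log(1+z^p)/z^p.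
Expanding L^s by the binomial theorem writes (n)_w [z^w] L^s, w = k(p-1), as a sum over j ≤ k of τ_j
times a cofactor, where τ_j is τ_u for the partition into j parts p-1. The cofactor is 1 for j = k,
and every other term is p-adically smaller than max |τ_j| (`padicNorm_sub_tauConst_lt`). A k that
maximizes |τ_k| then shows |τ_j| ≤ p^M for all j ≤ r (`padicNorm_tauConst_le`).

Hence B_n^{(l)}(1) ≡ τ_r modulo terms of norm less than p^M, and likewise B_n^{(l)}(0) if ν(l) ≤
ν(n). Each value has a pole of order M exactly when τ_r does. Legendre's formula for n! converts
this into the condition on the binomial coefficient. -/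

/-! ### Lagrange inversion for z = e^t - 1. -/

theorem todd_mul_expSubOneDiv : (todd : PowerSeries ℚ) * expSubOneDiv = 1 := by
  have := todd.mul_inv
  rwa [todd, inv_inv, IsUnit.unit_spec] at this

/-- `[t^m] (t / (e^t - 1))^(m+1) e^t = 0` for `m > 0`: the residue of an exact differential. -/
theorem coeff_todd_pow_mul_exp (m : ℕ) :
    PowerSeries.coeff m ((todd : PowerSeries ℚ) ^ (m + 1) * PowerSeries.exp ℚ) =
      if m = 0 then 1 else 0 := by
  have hTU := todd_mul_expSubOneDiv
  set T : PowerSeries ℚ := ↑todd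
  have hexp : expSubOneDiv + PowerSeries.X * PowerSeries.derivative ℚ expSubOneDiv =
      PowerSeries.exp ℚ := by
    have h := congrArg (PowerSeries.derivative ℚ) X_mul_expSubOneDiv
    rw [Derivation.leibniz, map_sub, PowerSeries.derivative_exp] at h
    simp only [PowerSeries.derivative_X, smul_eq_mul, Derivation.map_one_eq_zero] at h
    linear_combination h
  have hdT : PowerSeries.derivative ℚ T = -(T ^ 2 * PowerSeries.derivative ℚ expSubOneDiv) := by
    have h := congrArg (PowerSeries.derivative ℚ) hTU
    rw [Derivation.leibniz, Derivation.map_one_eq_zero, smul_eq_mul, smul_eq_mul] at h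
    linear_combination T * h - (PowerSeries.derivative ℚ T) * hTU
  rcases Nat.eq_zero_or_pos m with rfl | hm
  · have h := congrArg PowerSeries.constantCoeff hTU
    rw [map_mul, map_one] at h
    have h2 : PowerSeries.constantCoeff expSubOneDiv = 1 := by
      rw [← PowerSeries.coeff_zero_eq_constantCoeff_apply]; simp [expSubOneDiv]
    rw [h2, mul_one] at h
    simp [h]
  -- The operator t d/dt multiplies the coefficient of t^m by m, so the right side has no t^m term.
  · have key : (m : PowerSeries ℚ) * (T ^ (m + 1) * PowerSeries.exp ℚ) =
        (m : PowerSeries ℚ) * T ^ m - PowerSeries.X * PowerSeries.derivative ℚ (T ^ m) := by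
      obtain ⟨k, rfl⟩ : ∃ k, m = k + 1 := ⟨m - 1, by omega⟩
      rw [Derivation.leibniz_pow, hdT, ← hexp, Nat.add_sub_cancel, nsmul_eq_mul, smul_eq_mul]
      linear_combination (((k + 1 : ℕ) : PowerSeries ℚ) * T ^ (k + 1)) * hTU
    have h := congrArg (PowerSeries.coeff m) key
    obtain ⟨k, rfl⟩ : ∃ k, m = k + 1 := ⟨m - 1, by omega⟩
    have hc : ((k + 1 : ℕ) : PowerSeries ℚ) = PowerSeries.C ((k + 1 : ℕ) : ℚ) := by simp
    rw [map_sub, PowerSeries.coeff_succ_X_mul,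
      PowerSeries.coeff_derivative, hc, PowerSeries.coeff_C_mul, PowerSeries.coeff_C_mul] at h
    rw [if_neg (by omega)]
    have hk : ((k + 1 : ℕ) : ℚ) ≠ 0 := by positivity
    refine (mul_eq_zero.1 (h.trans ?_)).resolve_left hk
    push_cast; ring

/-- The power series `log (1 + z) / z`. -/
noncomputable def logDivSeries : PowerSeries ℚ :=
  PowerSeries.mk fun i => (-1) ^ i / ((i : ℚ) + 1)

theorem X_mul_logDivSeries : PowerSeries.X * logDivSeries = PowerSeries.log ℚ := by
  ext n
  cases n with
  | zero => simp
  | succ k =>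
    rw [PowerSeries.coeff_succ_X_mul, PowerSeries.coeff_log]
    simp [logDivSeries, pow_add]

theorem log_subst_exp_sub_one :
    (PowerSeries.log ℚ).subst (PowerSeries.exp ℚ - 1) = (PowerSeries.X : PowerSeries ℚ) := by
  have hE := PowerSeries.HasSubst.exp_sub_one (A := ℚ)
  apply PowerSeries.derivative.ext
  · rw [PowerSeries.derivative_subst hE, PowerSeries.derivative_X, PowerSeries.deriv_log, map_sub,
      PowerSeries.derivative_exp, Derivation.map_one_eq_zero, sub_zero]
    have h1 : (PowerSeries.mk fun n => algebraMap ℚ ℚ ((-1 : ℚ) ^ n)) * (1 + PowerSeries.X) = 1 := by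
      ext n
      cases n with
      | zero => simp [mul_add]
      | succ k => simp [mul_add, PowerSeries.coeff_succ_mul_X, pow_succ, PowerSeries.coeff_one]
    have h2 := congrArg (PowerSeries.subst (PowerSeries.exp ℚ - 1)) h1
    rw [← PowerSeries.coe_substAlgHom hE, map_mul, map_add, map_one, PowerSeries.substAlgHom_X,
      add_sub_cancel] at h2
    rw [← PowerSeries.coe_substAlgHom hE]
    exact h2
  · rw [PowerSeries.constantCoeff_X]
    exact PowerSeries.constantCoeff_subst_eq_zero
      (show PowerSeries.constantCoeff (PowerSeries.exp ℚ - 1) = 0 by simp) _ (by simp)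

/-- A power series with constant coefficient `1`, as a unit. -/
noncomputable def seriesUnit (f : PowerSeries ℚ) (h : PowerSeries.constantCoeff f = 1) :
    (PowerSeries ℚ)ˣ :=
  (PowerSeries.isUnit_iff_constantCoeff.2 (h ▸ isUnit_one) : IsUnit f).unit

@[simp]
theorem coe_seriesUnit (f : PowerSeries ℚ) (h : PowerSeries.constantCoeff f = 1) :
    (seriesUnit f h : PowerSeries ℚ) = f := rfl

theorem constantCoeff_logDivSeries : PowerSeries.constantCoeff logDivSeries = 1 := by
  rw [← PowerSeries.coeff_zero_eq_constantCoeff_apply]; simp [logDivSeries]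

/-- `log (1 + z) / z` as a unit. -/
noncomputable def logDiv : (PowerSeries ℚ)ˣ := seriesUnit logDivSeries constantCoeff_logDivSeries

/-- Substitution of `e^t - 1`. -/
noncomputable def substExp : PowerSeries ℚ →ₐ[ℚ] PowerSeries ℚ :=
  PowerSeries.substAlgHom (PowerSeries.HasSubst.exp_sub_one (A := ℚ))

theorem substExp_X : substExp PowerSeries.X = PowerSeries.exp ℚ - 1 :=
  PowerSeries.substAlgHom_X _

theorem substExp_logDivSeries : substExp logDivSeries = todd := by
  have h := log_subst_exp_sub_one
  rw [← PowerSeries.coe_substAlgHom PowerSeries.HasSubst.exp_sub_one, ← X_mul_logDivSeries,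
    map_mul, PowerSeries.substAlgHom_X] at h
  have h2 : expSubOneDiv * substExp logDivSeries = 1 := by
    refine mul_left_cancel₀ PowerSeries.X_ne_zero (Eq.trans ?_ (h.trans (mul_one _).symm))
    rw [← mul_assoc, X_mul_expSubOneDiv]
    rfl
  linear_combination (todd : PowerSeries ℚ) * h2 - substExp logDivSeries * todd_mul_expSubOneDiv

theorem substExp_logDiv_zpow (s : ℤ) :
    substExp ((logDiv ^ s : (PowerSeries ℚ)ˣ) : PowerSeries ℚ) =
      ((todd ^ s : (PowerSeries ℚ)ˣ) : PowerSeries ℚ) := by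
  have h : Units.map (substExp : PowerSeries ℚ →* PowerSeries ℚ) logDiv = todd :=
    Units.ext substExp_logDivSeries
  rw [← h, ← map_zpow]
  rfl

/-- Invariance of the residue under z = e^t - 1, by splitting g = z h + g(0): the factor z cancels
one power of t/(e^t-1) up to a factor t, which lowers n, and the constant is killed by
`coeff_todd_pow_mul_exp`. -/
theorem coeff_todd_pow_mul_exp_mul_substExp (n : ℕ) (g : PowerSeries ℚ) :
    PowerSeries.coeff n ((todd : PowerSeries ℚ) ^ (n + 1) * PowerSeries.exp ℚ * substExp g) =
      PowerSeries.coeff n g := by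
  induction n generalizing g with
  | zero =>
    have h1 := coeff_todd_pow_mul_exp 0
    rw [if_pos rfl, PowerSeries.coeff_zero_eq_constantCoeff_apply] at h1
    rw [PowerSeries.coeff_zero_eq_constantCoeff_apply, map_mul, h1, one_mul,
      PowerSeries.coeff_zero_eq_constantCoeff_apply]
    nth_rewrite 1 [PowerSeries.eq_X_mul_shift_add_const g]
    rw [map_add, map_mul, substExp_X]
    have : substExp (PowerSeries.C (PowerSeries.constantCoeff g)) =
        PowerSeries.C (PowerSeries.constantCoeff g) := substExp.commutes _
    rw [this]
    simp
  | succ n ih =>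
    have hg := PowerSeries.eq_X_mul_shift_add_const g
    set h : PowerSeries ℚ := PowerSeries.mk fun k => PowerSeries.coeff (k + 1) g with hh
    have hC : substExp (PowerSeries.C (PowerSeries.constantCoeff g)) =
        PowerSeries.C (PowerSeries.constantCoeff g) := substExp.commutes _
    have e : (todd : PowerSeries ℚ) ^ (n + 1 + 1) * PowerSeries.exp ℚ * substExp g =
        PowerSeries.X * ((todd : PowerSeries ℚ) ^ (n + 1) * PowerSeries.exp ℚ * substExp h) +
        PowerSeries.C (PowerSeries.constantCoeff g) *
          ((todd : PowerSeries ℚ) ^ (n + 1 + 1) * PowerSeries.exp ℚ) := by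
      nth_rewrite 1 [hg]
      rw [map_add, map_mul, substExp_X, ← X_mul_expSubOneDiv, hC]
      linear_combination ((todd : PowerSeries ℚ) ^ (n + 1) * PowerSeries.exp ℚ * PowerSeries.X
        * substExp h) * todd_mul_expSubOneDiv
    rw [e, map_add, PowerSeries.coeff_succ_X_mul, ih, PowerSeries.coeff_C_mul,
      coeff_todd_pow_mul_exp, if_neg (by omega), mul_zero, add_zero, hh, PowerSeries.coeff_mk]

/-- Lagrange inversion for `z = e^t - 1`. -/
theorem coeff_todd_zpow_mul_exp_mul_substExp (n : ℕ) (l : ℤ) (q : PowerSeries ℚ) :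
    PowerSeries.coeff n (((todd ^ l : (PowerSeries ℚ)ˣ) : PowerSeries ℚ) * PowerSeries.exp ℚ *
      substExp q) =
      PowerSeries.coeff n (((logDiv ^ (l - n - 1) : (PowerSeries ℚ)ˣ) : PowerSeries ℚ) * q) := by
  rw [← coeff_todd_pow_mul_exp_mul_substExp n (_ * q), map_mul substExp, substExp_logDiv_zpow]
  have : (todd ^ l : (PowerSeries ℚ)ˣ) = todd ^ (n + 1) * todd ^ (l - n - 1) := by
    rw [← zpow_natCast, ← zpow_add]; congr 1; push_cast; ring
  rw [this, Units.val_mul, Units.val_pow_eq_pow_val]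
  congr 1; ring

/-! ### Bernoulli values as coefficients of powers of log(1+z)/z. -/

theorem eval_hoBernoulli (n : ℕ) (l : ℤ) (x : ℚ) :
    (hoBernoulli n l).eval x = (n ! : ℚ) * PowerSeries.coeff n
      (((todd ^ l : (PowerSeries ℚ)ˣ) : PowerSeries ℚ) *
        PowerSeries.rescale x (PowerSeries.exp ℚ)) := by
  rw [hoBernoulli, Polynomial.eval_smul, smul_eq_mul, PowerSeries.coeff_mul,
    PowerSeries.coeff_mul, Polynomial.eval_finsetSum]
  congr 1
  refine Finset.sum_congr rfl fun i _ => ?_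
  have h : (algebraMap ℚ (Polynomial ℚ)) = Polynomial.C := rfl
  simp [PowerSeries.coeff_rescale, PowerSeries.coeff_exp, h]
  simp only [← one_div]
  exact Or.inl (mul_comm _ _)

theorem eval_natCast_add_one_hoBernoulli (n : ℕ) (l : ℤ) (N : ℕ) :
    (hoBernoulli n l).eval ((N : ℚ) + 1) = (n ! : ℚ) * PowerSeries.coeff n
      (((logDiv ^ (l - n - 1) : (PowerSeries ℚ)ˣ) : PowerSeries ℚ) *
        (1 + PowerSeries.X) ^ N) := by
  rw [eval_hoBernoulli, ← coeff_todd_zpow_mul_exp_mul_substExp, map_pow, map_add, map_one,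
    substExp_X, add_sub_cancel, mul_assoc, ← pow_succ', PowerSeries.exp_pow_eq_rescale_exp]
  push_cast
  rfl

theorem eval_one_hoBernoulli (n : ℕ) (l : ℤ) :
    (hoBernoulli n l).eval 1 = (n ! : ℚ) * PowerSeries.coeff n
      ((logDiv ^ (l - n - 1) : (PowerSeries ℚ)ˣ) : PowerSeries ℚ) := by
  have := eval_natCast_add_one_hoBernoulli n l 0
  simpa using this

/-- The unit `1 + z`. -/
noncomputable def oneAddX : (PowerSeries ℚ)ˣ := seriesUnit (1 + PowerSeries.X) (by simp)

theorem eval_zero_hoBernoulli (n : ℕ) (l : ℤ) :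
    (hoBernoulli n l).eval 0 = (n ! : ℚ) * PowerSeries.coeff n
      (((logDiv ^ (l - n - 1) : (PowerSeries ℚ)ˣ) : PowerSeries ℚ) *
        ((oneAddX⁻¹ : (PowerSeries ℚ)ˣ) : PowerSeries ℚ)) := by
  have h : PowerSeries.exp ℚ * substExp ((oneAddX⁻¹ : (PowerSeries ℚ)ˣ) : PowerSeries ℚ) = 1 := by
    have := congrArg substExp oneAddX.mul_inv
    rwa [map_mul, oneAddX, coe_seriesUnit, map_add, map_one, substExp_X, add_sub_cancel] at this
  rw [eval_hoBernoulli, ← coeff_todd_zpow_mul_exp_mul_substExp, mul_assoc, h]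
  congr 3
  ext n
  rw [PowerSeries.coeff_rescale]
  cases n <;> simp [PowerSeries.coeff_one]

/-- Expansion of `B_n^{(l)}(x + 1)` in falling factorials. -/
theorem hoBernoulli_comp_X_add_one (n : ℕ) (l : ℤ) :
    (hoBernoulli n l).comp (Polynomial.X + 1) = ∑ k ∈ Finset.range (n + 1),
      Polynomial.C ((n.descFactorial (n - k) : ℚ) * PowerSeries.coeff (n - k)
        ((logDiv ^ (l - n - 1) : (PowerSeries ℚ)ˣ) : PowerSeries ℚ)) * descPochhammer ℚ k := by
  -- It suffices to compare values at natural numbers N, where (1+z)^N has coefficients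
  -- N(N-1)⋯(N-k+1)/k!.
  apply Polynomial.eq_of_infinite_eval_eq
  refine (Set.infinite_range_of_injective (Nat.cast_injective (R := ℚ))).mono ?_
  rintro _ ⟨N, rfl⟩
  rw [Set.mem_ofPred_eq, Polynomial.eval_comp, Polynomial.eval_add, Polynomial.eval_X,
    Polynomial.eval_one, eval_natCast_add_one_hoBernoulli, Polynomial.eval_finsetSum,
    mul_comm _ ((1 + PowerSeries.X) ^ N), PowerSeries.coeff_mul,
    Finset.Nat.sum_antidiagonal_eq_sum_range_succ_mk, Finset.mul_sum]
  refine Finset.sum_congr rfl fun k hk => ?_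
  have hkn : k ≤ n := by simpa [Nat.lt_succ_iff] using hk
  rw [Polynomial.eval_mul, Polynomial.eval_C, descPochhammer_eval_eq_descFactorial]
  have h1 : PowerSeries.coeff k ((1 + PowerSeries.X : PowerSeries ℚ) ^ N) = (N.choose k : ℚ) := by
    have h := Polynomial.coeff_one_add_X_pow ℚ N k
    rw [← Polynomial.coeff_coe] at h
    simpa using h
  have h2 : (n ! : ℚ) = (k ! : ℚ) * (n.descFactorial (n - k) : ℚ) := by
    have := Nat.factorial_mul_descFactorial (Nat.sub_le n k)
    rw [Nat.sub_sub_self hkn] at this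
    exact_mod_cast this.symm
  rw [h1, h2, Nat.descFactorial_eq_factorial_mul_choose N k]
  push_cast
  ring

/-! ### The maximum pole and the falling factorial basis. -/

theorem padicValNat_den_le_iff (p : ℕ) [hp : Fact p.Prime] (q : ℚ) (K : ℕ) :
    padicValNat p q.den ≤ K ↔ padicNorm p q ≤ (p : ℚ) ^ K := by
  have hp1 : (1 : ℚ) < p := by exact_mod_cast hp.out.one_lt
  rcases eq_or_ne q 0 with rfl | hq
  · simp
  rw [padicNorm.eq_zpow_of_nonzero hq, ← zpow_natCast, zpow_le_zpow_iff_right₀ hp1, padicValRat]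
  by_cases h : p ∣ q.den
  · have h2 : ¬ p ∣ q.num.natAbs := fun h3 =>
      hp.out.one_lt.ne' (Nat.dvd_one.1 (q.reduced ▸ Nat.dvd_gcd h3 h))
    rw [padicValInt, padicValNat.eq_zero_of_not_dvd h2]
    omega
  · rw [padicValNat.eq_zero_of_not_dvd h]
    omega

/-- All coefficients of `f` have `p`-adic norm at most `c`. -/
def CoeffBound (p : ℕ) (c : ℚ) (f : Polynomial ℚ) : Prop :=
  ∀ i, padicNorm p (f.coeff i) ≤ c

theorem maxPole_le_iff (p : ℕ) [Fact p.Prime] (f : Polynomial ℚ) (K : ℕ) :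
    maxPole p f ≤ K ↔ CoeffBound p ((p : ℚ) ^ K) f := by
  rw [maxPole, Finset.sup_le_iff]
  refine ⟨fun h i => ?_, fun h i _ => (padicValNat_den_le_iff p _ K).2 (h i)⟩
  by_cases hi : f.coeff i = 0
  · rw [hi, padicNorm.zero]; positivity
  · exact (padicValNat_den_le_iff p _ K).1 (h i (Polynomial.mem_support_iff.2 hi))

section CoeffBound

variable {p : ℕ} [hp : Fact p.Prime] {c : ℚ}

theorem CoeffBound.sum {α : Type*} {s : Finset α} {F : α → Polynomial ℚ} (hc : 0 ≤ c)
    (h : ∀ i ∈ s, CoeffBound p c (F i)) : CoeffBound p c (∑ i ∈ s, F i) := by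
  intro j
  rw [Polynomial.finsetSum_coeff]
  exact padicNorm.sum_le' (fun i hi => h i hi j) hc

theorem CoeffBound.sub {f g : Polynomial ℚ} (hf : CoeffBound p c f) (hg : CoeffBound p c g) :
    CoeffBound p c (f - g) := fun i => by
  rw [Polynomial.coeff_sub]
  exact padicNorm.sub.trans (max_le (hf i) (hg i))

theorem CoeffBound.C_mul_map {a : ℚ} (ha : padicNorm p a ≤ c) (g : Polynomial ℤ) :
    CoeffBound p c (Polynomial.C a * g.map (Int.castRingHom ℚ)) := fun i => by
  rw [Polynomial.coeff_C_mul, Polynomial.coeff_map, padicNorm.mul]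
  calc _ ≤ padicNorm p a * 1 :=
        mul_le_mul_of_nonneg_left (padicNorm.of_int _) (padicNorm.nonneg _)
    _ ≤ c := by rwa [mul_one]

theorem CoeffBound.comp_map {f : Polynomial ℚ} (hc : 0 ≤ c) (hf : CoeffBound p c f)
    (g : Polynomial ℤ) : CoeffBound p c (f.comp (g.map (Int.castRingHom ℚ))) := by
  rw [Polynomial.comp_eq_sum_left, Polynomial.sum]
  refine CoeffBound.sum hc fun i _ => ?_
  rw [← Polynomial.map_pow]
  exact CoeffBound.C_mul_map (hf i) _

/-- The maximum pole is invariant under the translation `x ↦ x + 1`. -/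
theorem maxPole_comp_X_add_one (p : ℕ) [Fact p.Prime] (f : Polynomial ℚ) :
    maxPole p (f.comp (Polynomial.X + 1)) = maxPole p f := by
  have h : ∀ (g : Polynomial ℚ) (e : Polynomial ℤ),
      maxPole p (g.comp (e.map (Int.castRingHom ℚ))) ≤ maxPole p g := fun g e =>
    (maxPole_le_iff p _ _).2 (((maxPole_le_iff p g _).1 le_rfl).comp_map (by positivity) e)
  apply le_antisymm
  · have := h f (Polynomial.X + 1)
    rwa [Polynomial.map_add, Polynomial.map_X, Polynomial.map_one] at this
  · have := h (f.comp (Polynomial.X + 1)) (Polynomial.X - 1)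
    rw [Polynomial.map_sub, Polynomial.map_X, Polynomial.map_one] at this
    simpa [Polynomial.comp_assoc] using this

/-- The leading coefficient of the sum is the last `a k`, since falling factorials are monic of
distinct degrees; subtracting that term keeps the bound because they have integer coefficients. -/
theorem CoeffBound.of_sum_descPochhammer {n : ℕ} {a : ℕ → ℚ}
    (h : CoeffBound p c (∑ k ∈ Finset.range n, Polynomial.C (a k) * descPochhammer ℚ k)) :
    ∀ k < n, padicNorm p (a k) ≤ c := by
  induction n with
  | zero => intro k hk; omega
  | succ n ih =>
    have hn : padicNorm p (a n) ≤ c := by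
      have h1 := h n
      rw [Finset.sum_range_succ, Polynomial.coeff_add, Polynomial.finsetSum_coeff,
        Finset.sum_eq_zero, zero_add, Polynomial.coeff_C_mul] at h1
      · have h2 : (descPochhammer ℚ n).coeff n = 1 := by
          have := (monic_descPochhammer ℚ n).coeff_natDegree
          rwa [descPochhammer_natDegree] at this
        rwa [h2, mul_one] at h1
      · intro k hk
        rw [Polynomial.coeff_C_mul, Polynomial.coeff_eq_zero_of_natDegree_lt, mul_zero]
        rw [descPochhammer_natDegree]
        exact Finset.mem_range.1 hk
    have h3 : CoeffBound p c
        (∑ k ∈ Finset.range n, Polynomial.C (a k) * descPochhammer ℚ k) := by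
      have h4 : CoeffBound p c (Polynomial.C (a n) * descPochhammer ℚ n) := by
        rw [← descPochhammer_map (Int.castRingHom ℚ)]
        exact CoeffBound.C_mul_map hn _
      have := h.sub h4
      rwa [Finset.sum_range_succ, add_sub_cancel_right] at this
    intro k hk
    rcases Nat.lt_succ_iff_lt_or_eq.1 hk with hk | rfl
    · exact ih h3 k hk
    · exact hn

end CoeffBound

theorem padicNorm_descFactorial_mul_coeff_le (p : ℕ) [Fact p.Prime] (n : ℕ) (l : ℤ) {w : ℕ}
    (hw : w ≤ n) :
    padicNorm p ((n.descFactorial w : ℚ) * PowerSeries.coeff w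
        ((logDiv ^ (l - n - 1) : (PowerSeries ℚ)ˣ) : PowerSeries ℚ)) ≤
      (p : ℚ) ^ maxPole p (hoBernoulli n l) := by
  have h := (maxPole_le_iff p _ _).1 (maxPole_comp_X_add_one p (hoBernoulli n l)).le
  rw [hoBernoulli_comp_X_add_one] at h
  have := CoeffBound.of_sum_descPochhammer h (n - w) (by omega)
  rwa [Nat.sub_sub_self hw] at this

/-! ### Binomial expansion with integer exponents. -/

/-- Going from s to s + 1 multiplies the error by the unit F, up to a multiple of H^(K+1). The
claims for s and s + 1 are therefore equivalent, and induction runs in both directions. -/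
theorem pow_dvd_add_zpow_sub {A : Type*} [CommRing A] (F G : Aˣ) (H : A) (hF : (F : A) = G + H)
    (K : ℕ) (s : ℤ) :
    H ^ (K + 1) ∣ ((F ^ s : Aˣ) : A) - ∑ j ∈ Finset.range (K + 1),
      ((Ring.choose s j : ℤ) : A) * H ^ j * ((G ^ (s - j) : Aˣ) : A) := by
  have hG : ∀ t : ℤ, (G : A) * ((G ^ t : Aˣ) : A) = ((G ^ (t + 1) : Aˣ) : A) := fun t => by
    rw [← Units.val_mul, ← zpow_one_add, add_comm]
  have hstep : ∀ s : ℤ, H ^ (K + 1) ∣ ((F ^ (s + 1) : Aˣ) : A) - ∑ j ∈ Finset.range (K + 1),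
        ((Ring.choose (s + 1) j : ℤ) : A) * H ^ j * ((G ^ (s + 1 - j) : Aˣ) : A) ↔
      H ^ (K + 1) ∣ ((F ^ s : Aˣ) : A) - ∑ j ∈ Finset.range (K + 1),
        ((Ring.choose s j : ℤ) : A) * H ^ j * ((G ^ (s - j) : Aˣ) : A) := by
    intro s
    have e : ((F ^ (s + 1) : Aˣ) : A) - ∑ j ∈ Finset.range (K + 1),
          ((Ring.choose (s + 1) j : ℤ) : A) * H ^ j * ((G ^ (s + 1 - j) : Aˣ) : A) =
        F * (((F ^ s : Aˣ) : A) - ∑ j ∈ Finset.range (K + 1),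
          ((Ring.choose s j : ℤ) : A) * H ^ j * ((G ^ (s - j) : Aˣ) : A)) +
        H ^ (K + 1) * (((Ring.choose s K : ℤ) : A) * ((G ^ (s - K) : Aˣ) : A)) := by
      have e1 : ((F ^ (s + 1) : Aˣ) : A) = F * ((F ^ s : Aˣ) : A) := by
        rw [← Units.val_mul, ← zpow_one_add, add_comm]
      have e2 : (G : A) * ∑ j ∈ Finset.range (K + 1),
            ((Ring.choose s j : ℤ) : A) * H ^ j * ((G ^ (s - j) : Aˣ) : A) =
          ∑ j ∈ Finset.range K,
            ((Ring.choose s (j + 1) : ℤ) : A) * H ^ (j + 1) * ((G ^ (s - j) : Aˣ) : A) +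
          ((G ^ (s + 1) : Aˣ) : A) := by
        rw [Finset.sum_range_succ', mul_add, Finset.mul_sum]
        congr 1
        · refine Finset.sum_congr rfl fun j _ => ?_
          have := hG (s - (j + 1 : ℕ))
          rw [show s - ((j + 1 : ℕ) : ℤ) + 1 = s - j by push_cast; ring] at this
          rw [← this]; ring
        · simp [hG]
      have e3 : H * ∑ j ∈ Finset.range (K + 1),
            ((Ring.choose s j : ℤ) : A) * H ^ j * ((G ^ (s - j) : Aˣ) : A) =
          ∑ j ∈ Finset.range K,
            ((Ring.choose s j : ℤ) : A) * H ^ (j + 1) * ((G ^ (s - j) : Aˣ) : A) +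
          H ^ (K + 1) * (((Ring.choose s K : ℤ) : A) * ((G ^ (s - K) : Aˣ) : A)) := by
        rw [Finset.sum_range_succ, mul_add, Finset.mul_sum]
        congr 1
        · exact Finset.sum_congr rfl fun j _ => by ring
        · ring
      have e4 : ∑ j ∈ Finset.range (K + 1),
            ((Ring.choose (s + 1) j : ℤ) : A) * H ^ j * ((G ^ (s + 1 - j) : Aˣ) : A) =
          ∑ j ∈ Finset.range K,
            ((Ring.choose s j : ℤ) : A) * H ^ (j + 1) * ((G ^ (s - j) : Aˣ) : A) +
          ∑ j ∈ Finset.range K,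
            ((Ring.choose s (j + 1) : ℤ) : A) * H ^ (j + 1) * ((G ^ (s - j) : Aˣ) : A) +
          ((G ^ (s + 1) : Aˣ) : A) := by
        rw [Finset.sum_range_succ', ← Finset.sum_add_distrib]
        congr 1
        · refine Finset.sum_congr rfl fun j _ => ?_
          rw [Ring.choose_succ_succ, show s + 1 - ((j + 1 : ℕ) : ℤ) = s - j by push_cast; ring]
          push_cast; ring
        · simp
      rw [e4, e1, mul_sub, hF, add_mul (G : A) H (∑ _ ∈ _, _), e2, e3]
      ring
    rw [e, dvd_add_left (dvd_mul_right _ _), Units.dvd_mul_left]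
  induction s using Int.induction_on with
  | zero =>
    rw [Finset.sum_range_succ']
    simp [Ring.choose_zero_succ]
  | succ i ih => exact (hstep _).2 ih
  | pred i ih =>
    refine (hstep _).1 ?_
    rwa [sub_add_cancel]

/-! ### Series with controlled p-adic growth. -/

theorem div_sub_one_add_div_sub_one_le (a b c : ℕ) :
    (a / c - 1) + (b / c - 1) ≤ (a + b) / c - 1 := by
  have := @Nat.div_add_div_le_add_div a b c
  generalize a / c = x at *
  generalize b / c = y at *
  generalize (a + b) / c = z at *
  omega

/-- The power series whose `m`-th coefficient has `p`-adic norm at most `p ^ (⌊m / p⌋ - 1)`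
(truncated subtraction). -/
def growthSubring (p : ℕ) [hp : Fact p.Prime] : Subring (PowerSeries ℚ) where
  carrier := {f | ∀ m, padicNorm p (PowerSeries.coeff m f) ≤ (p : ℚ) ^ (m / p - 1)}
  one_mem' m := by
    have h1 : (1 : ℚ) ≤ p := by exact_mod_cast hp.out.one_le
    rw [PowerSeries.coeff_one]
    split_ifs
    · rw [padicNorm.one]; exact one_le_pow₀ h1
    · rw [padicNorm.zero]; positivity
  zero_mem' m := by rw [map_zero, padicNorm.zero]; positivity
  add_mem' hf hg m := by
    rw [map_add]; exact padicNorm.nonarchimedean.trans (max_le (hf m) (hg m))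
  neg_mem' hf m := by rw [map_neg, padicNorm.neg]; exact hf m
  mul_mem' {f g} hf hg m := by
    have h1 : (1 : ℚ) ≤ p := by exact_mod_cast hp.out.one_le
    rw [PowerSeries.coeff_mul]
    refine padicNorm.sum_le' (fun x hx => ?_) (by positivity)
    rw [Finset.HasAntidiagonal.mem_antidiagonal] at hx
    rw [padicNorm.mul]
    refine (mul_le_mul (hf _) (hg _) (padicNorm.nonneg _) (by positivity)).trans ?_
    rw [← pow_add]
    refine pow_le_pow_right₀ h1 ?_
    have := div_sub_one_add_div_sub_one_le x.1 x.2 p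
    rwa [hx] at this

section growthSubring

variable {p : ℕ} [hp : Fact p.Prime]

/-- Writing f = 1 + z d gives g = 1 - z d g for the inverse, a recursion for the coefficients of g.
-/
theorem inv_mem_growthSubring {f : PowerSeries ℚ} (hf : f ∈ growthSubring p)
    (h : PowerSeries.constantCoeff f = 1) :
    (((seriesUnit f h)⁻¹ : (PowerSeries ℚ)ˣ) : PowerSeries ℚ) ∈ growthSubring p := by
  have h1 : (1 : ℚ) ≤ p := by exact_mod_cast hp.out.one_le
  have hfg := (seriesUnit f h).mul_inv
  rw [coe_seriesUnit] at hfg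
  set g : PowerSeries ℚ := ↑(seriesUnit f h)⁻¹
  intro m
  induction m using Nat.strong_induction_on with
  | _ m ih =>
    have hs := PowerSeries.eq_X_mul_shift_add_const f
    rw [h, map_one] at hs
    set d : PowerSeries ℚ := PowerSeries.mk fun k => PowerSeries.coeff (k + 1) f with hd
    have hg : g = 1 - PowerSeries.X * (d * g) := by
      linear_combination hfg - g * hs
    rw [hg]
    cases m with
    | zero => simp
    | succ m =>
      rw [map_sub, PowerSeries.coeff_succ_X_mul, PowerSeries.coeff_one, if_neg (by omega),
        zero_sub, padicNorm.neg, PowerSeries.coeff_mul]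
      refine padicNorm.sum_le' (fun x hx => ?_) (by positivity)
      rw [Finset.HasAntidiagonal.mem_antidiagonal] at hx
      rw [padicNorm.mul, hd, PowerSeries.coeff_mk]
      refine (mul_le_mul (hf _) (ih _ (by omega)) (padicNorm.nonneg _) (by positivity)).trans ?_
      rw [← pow_add]
      refine pow_le_pow_right₀ h1 ?_
      have := div_sub_one_add_div_sub_one_le (x.1 + 1) x.2 p
      rwa [show x.1 + 1 + x.2 = m + 1 by omega] at this

theorem zpow_mem_growthSubring {f : PowerSeries ℚ} (hf : f ∈ growthSubring p)
    (h : PowerSeries.constantCoeff f = 1) (t : ℤ) :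
    (((seriesUnit f h) ^ t : (PowerSeries ℚ)ˣ) : PowerSeries ℚ) ∈ growthSubring p := by
  cases t with
  | ofNat t =>
    rw [Int.ofNat_eq_natCast, zpow_natCast, Units.val_pow_eq_pow_val]
    exact pow_mem (by exact hf) _
  | negSucc t =>
    rw [zpow_negSucc, ← inv_pow, Units.val_pow_eq_pow_val]
    exact pow_mem (inv_mem_growthSubring hf h) _

end growthSubring

theorem constantCoeff_zpow_seriesUnit (f : PowerSeries ℚ) (h : PowerSeries.constantCoeff f = 1)
    (t : ℤ) : PowerSeries.constantCoeff (((seriesUnit f h) ^ t : (PowerSeries ℚ)ˣ) :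
      PowerSeries ℚ) = 1 := by
  have h1 : Units.map ((PowerSeries.constantCoeff : PowerSeries ℚ →+* ℚ) : PowerSeries ℚ →* ℚ) (seriesUnit f h) = 1 :=
    Units.ext h
  have h2 := congrArg (fun u : ℚˣ => ((u ^ t : ℚˣ) : ℚ)) h1
  simp only [← map_zpow, one_zpow, Units.val_one] at h2
  exact h2

/-! ### Splitting off the terms of log(1+z)/z with denominator divisible by p. -/

/-- The terms of `log (1 + z) / z` whose denominators are prime to `p`. -/
noncomputable def coprimePart (p : ℕ) : PowerSeries ℚ :=
  PowerSeries.mk fun i => if p ∣ i + 1 then 0 else (-1) ^ i / ((i : ℚ) + 1)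

/-- The power series `log (1 + z^p) / z^p`. -/
noncomputable def logDivExpand (p : ℕ) : PowerSeries ℚ :=
  PowerSeries.mk fun i => if p ∣ i then (-1) ^ (i / p) / (((i / p : ℕ) : ℚ) + 1) else 0

theorem logDivSeries_eq {p : ℕ} (hp : p.Prime) (hodd : Odd p) :
    logDivSeries = coprimePart p +
      PowerSeries.X ^ (p - 1) * (PowerSeries.C (1 / (p : ℚ)) * logDivExpand p) := by
  have hp0 : (p : ℚ) ≠ 0 := by exact_mod_cast hp.ne_zero
  have hp1 := hp.one_le
  ext i
  rw [map_add, PowerSeries.coeff_X_pow_mul', PowerSeries.coeff_C_mul, logDivSeries, coprimePart,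
    logDivExpand, PowerSeries.coeff_mk, PowerSeries.coeff_mk, PowerSeries.coeff_mk]
  by_cases h : p ∣ i + 1
  · obtain ⟨k, hk⟩ := h
    obtain ⟨k, rfl⟩ : ∃ j, k = j + 1 := ⟨k - 1, by rcases k with _ | k <;> simp at hk ⊢⟩
    have hi : i = p * k + (p - 1) := by rw [mul_add] at hk; omega
    have e1 : i - (p - 1) = p * k := by omega
    have hc : (i : ℚ) + 1 = p * (k + 1) := by exact_mod_cast hk
    -- Oddness of p makes the signs match.
    have hsgn : (-1 : ℚ) ^ i = (-1) ^ k := by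
      rw [hi, pow_add, pow_mul, hodd.neg_one_pow,
        (Nat.Odd.sub_odd hodd odd_one).neg_one_pow, mul_one]
    rw [if_pos ⟨k + 1, hk⟩, if_pos (by omega), e1, if_pos (dvd_mul_right _ _),
      Nat.mul_div_cancel_left _ hp.pos, hsgn, hc, zero_add]
    field_simp
  · rw [if_neg h]
    by_cases h2 : p - 1 ≤ i
    · rw [if_pos h2, if_neg, mul_zero, add_zero]
      rintro h3
      apply h
      rw [show i + 1 = i - (p - 1) + p by omega]
      exact dvd_add h3 dvd_rfl
    · rw [if_neg h2, add_zero]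

theorem constantCoeff_coprimePart {p : ℕ} (hp : p.Prime) :
    PowerSeries.constantCoeff (coprimePart p) = 1 := by
  rw [← PowerSeries.coeff_zero_eq_constantCoeff_apply]
  simp [coprimePart, hp.ne_one]

theorem constantCoeff_logDivExpand (p : ℕ) :
    PowerSeries.constantCoeff (logDivExpand p) = 1 := by
  rw [← PowerSeries.coeff_zero_eq_constantCoeff_apply]
  simp [logDivExpand]

theorem coprimePart_mem_growthSubring (p : ℕ) [hp : Fact p.Prime] :
    coprimePart p ∈ growthSubring p := by
  have h1 : (1 : ℚ) ≤ p := by exact_mod_cast hp.out.one_le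
  intro i
  rw [coprimePart, PowerSeries.coeff_mk]
  split_ifs with h
  · rw [padicNorm.zero]; positivity
  · have e : padicNorm p ((i : ℚ) + 1) = 1 := by
      exact_mod_cast (padicNorm.nat_eq_one_iff (p := p) (i + 1)).2 h
    have e2 : padicNorm p ((-1 : ℚ) ^ i) ≤ 1 := by
      exact_mod_cast padicNorm.of_int (p := p) ((-1) ^ i)
    rw [padicNorm.div, e, div_one]
    exact e2.trans (one_le_pow₀ h1)

theorem logDivExpand_mem_growthSubring (p : ℕ) [hp : Fact p.Prime] (h3 : 3 ≤ p) :
    logDivExpand p ∈ growthSubring p := by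
  have h1 : (1 : ℚ) ≤ p := by exact_mod_cast hp.out.one_le
  intro i
  rw [logDivExpand, PowerSeries.coeff_mk]
  split_ifs with h
  · obtain ⟨k, rfl⟩ := h
    rw [Nat.mul_div_cancel_left _ hp.out.pos]
    have e2 : padicNorm p ((-1 : ℚ) ^ k) ≤ 1 := by
      exact_mod_cast padicNorm.of_int (p := p) ((-1) ^ k)
    have e : padicNorm p ((k : ℚ) + 1) = (p : ℚ) ^ (-(padicValNat p (k + 1) : ℤ)) := by
      have := padicNorm.eq_zpow_of_nonzero (p := p) (q := ((k + 1 : ℕ) : ℚ))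
        (by exact_mod_cast k.succ_ne_zero)
      rw [padicValRat.of_nat] at this
      exact_mod_cast this
    rw [padicNorm.div, e, zpow_neg, div_inv_eq_mul, zpow_natCast]
    refine (mul_le_of_le_one_left (by positivity) e2).trans (pow_le_pow_right₀ h1 ?_)
    have hdvd := Nat.le_of_dvd k.succ_pos (pow_padicValNat_dvd (p := p) (n := k + 1))
    set v := padicValNat p (k + 1)
    rcases Nat.eq_zero_or_pos v with hv | hv
    · omega
    -- The coefficient at pk has norm p^v and may reach p^(k-1); v + 2 ≤ 3^v ≤ p^v ≤ k + 1 suffices,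
    -- which needs p ≥ 3.
    · have : ∀ v : ℕ, 1 ≤ v → v + 2 ≤ 3 ^ v := by
        intro v hv
        induction v, hv using Nat.le_induction with
        | base => norm_num
        | succ m _ ih => rw [pow_succ]; omega
      have h4 := this v hv
      have h5 : 3 ^ v ≤ p ^ v := Nat.pow_le_pow_left h3 v
      omega
  · rw [padicNorm.zero]; positivity

/-! ### Dominance of the partitions into parts p - 1. -/

/-- The value `τ_u(s)` at the partition consisting of `j` parts `p - 1`. -/
noncomputable def tauConst (p n : ℕ) (s : ℤ) (j : ℕ) : ℚ :=
  (n.descFactorial (j * (p - 1)) : ℚ) * ((Ring.choose s j : ℤ) : ℚ) / (p : ℚ) ^ j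

section

variable {p : ℕ} [hp : Fact p.Prime]

/-- The series `(log (1 + z^p) / z^p)^j G^(s - j)`, where `G` is the prime-to-`p` part of
`log (1 + z) / z`. -/
noncomputable def cofactor (p : ℕ) [hp : Fact p.Prime] (s : ℤ) (j : ℕ) : PowerSeries ℚ :=
  logDivExpand p ^ j *
    ((seriesUnit (coprimePart p) (constantCoeff_coprimePart hp.out) ^ (s - j) :
      (PowerSeries ℚ)ˣ) : PowerSeries ℚ)

theorem cofactor_mem_growthSubring (h3 : 3 ≤ p) (s : ℤ) (j : ℕ) :
    cofactor p s j ∈ growthSubring p :=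
  mul_mem (pow_mem (logDivExpand_mem_growthSubring p h3) j)
    (zpow_mem_growthSubring (coprimePart_mem_growthSubring p) _ _)

theorem constantCoeff_cofactor (s : ℤ) (j : ℕ) :
    PowerSeries.constantCoeff (cofactor p s j) = 1 := by
  rw [cofactor, map_mul, map_pow, constantCoeff_logDivExpand, constantCoeff_zpow_seriesUnit,
    one_pow, one_mul]

theorem descFactorial_mul_coeff_logDiv_zpow_mul (hodd : Odd p) {n k : ℕ} (s : ℤ)
    (Q : PowerSeries ℚ) :
    (n.descFactorial (k * (p - 1)) : ℚ) * PowerSeries.coeff (k * (p - 1))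
        (((logDiv ^ s : (PowerSeries ℚ)ˣ) : PowerSeries ℚ) * Q) =
      ∑ j ∈ Finset.range (k + 1), tauConst p n s j *
        (((n - j * (p - 1)).descFactorial ((k - j) * (p - 1)) : ℚ) *
          PowerSeries.coeff ((k - j) * (p - 1)) (cofactor p s j * Q)) := by
  have hp2 := hp.out.two_le
  obtain ⟨R, hR⟩ := pow_dvd_add_zpow_sub logDiv
    (seriesUnit (coprimePart p) (constantCoeff_coprimePart hp.out)) _
    (logDivSeries_eq hp.out hodd) k s
  rw [sub_eq_iff_eq_add] at hR
  have e1 : PowerSeries.coeff (k * (p - 1))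
      ((PowerSeries.X ^ (p - 1) * (PowerSeries.C (1 / (p : ℚ)) * logDivExpand p)) ^ (k + 1) * R * Q)
        = 0 := by
    -- The remainder starts in degree (p-1)(k+1), beyond k(p-1).
    rw [mul_pow, ← pow_mul, mul_assoc, mul_assoc, PowerSeries.coeff_X_pow_mul', if_neg]
    rw [mul_add, mul_comm]
    omega
  rw [hR, add_mul, map_add, e1, zero_add, Finset.sum_mul, map_sum, Finset.mul_sum]
  refine Finset.sum_congr rfl fun j hj => ?_
  have hjk : j ≤ k := by simpa [Nat.lt_succ_iff] using hj
  have hsub : k * (p - 1) - j * (p - 1) = (k - j) * (p - 1) := (Nat.sub_mul _ _ _).symm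
  have hle : j * (p - 1) ≤ k * (p - 1) := Nat.mul_le_mul_right _ hjk
  have e2 : ((Ring.choose s j : ℤ) : PowerSeries ℚ) *
      (PowerSeries.X ^ (p - 1) * (PowerSeries.C (1 / (p : ℚ)) * logDivExpand p)) ^ j *
      ((seriesUnit (coprimePart p) (constantCoeff_coprimePart hp.out) ^ (s - j) :
        (PowerSeries ℚ)ˣ) : PowerSeries ℚ) * Q =
      PowerSeries.X ^ (j * (p - 1)) *
        (PowerSeries.C (((Ring.choose s j : ℤ) : ℚ) * (1 / (p : ℚ)) ^ j) *
          (cofactor p s j * Q)) := by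
    rw [map_mul, map_pow, map_intCast, cofactor, mul_pow, mul_pow, ← pow_mul, mul_comm (p - 1) j]
    ring
  rw [e2, PowerSeries.coeff_X_pow_mul', if_pos hle, hsub, PowerSeries.coeff_C_mul, tauConst,
    ← Nat.descFactorial_mul_descFactorial hle, hsub]
  push_cast
  rw [one_div, inv_pow]
  ring

/-- The falling factorial is divisible by m!, hence by p^⌊m/p⌋, one power more than the denominator
of the coefficient can contain. -/
theorem padicNorm_descFactorial_mul_coeff_lt_one {f : PowerSeries ℚ} (hf : f ∈ growthSubring p)
    {m : ℕ} (hm : p ≤ m) (N : ℕ) :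
    padicNorm p ((N.descFactorial m : ℚ) * PowerSeries.coeff m f) < 1 := by
  have hp1 : (1 : ℚ) < p := by exact_mod_cast hp.out.one_lt
  have h1 : p ^ (m / p) ∣ N.descFactorial m := by
    refine dvd_trans ?_ (Nat.factorial_dvd_descFactorial N m)
    have h2 : p ^ (m / p) ∣ (p * (m / p))! := by
      generalize m / p = a
      induction a with
      | zero => simp
      | succ a ih =>
        rw [pow_succ', mul_add, mul_one]
        have h3 : (p * a + p)! = (p * a + p) * (p * a + (p - 1))! := by
          obtain ⟨q, hq⟩ : ∃ q, p = q + 1 := ⟨p - 1, by have := hp.out.pos; omega⟩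
          have : p * a + p = (p * a + (p - 1)) + 1 := by omega
          rw [this, Nat.factorial_succ]
        rw [h3]
        exact mul_dvd_mul (Dvd.intro (a + 1) (by ring))
          (ih.trans (Nat.factorial_dvd_factorial (by omega)))
    exact h2.trans (Nat.factorial_dvd_factorial (Nat.mul_div_le m p))
  have h4 : padicNorm p (N.descFactorial m : ℚ) ≤ (p : ℚ) ^ (-((m / p : ℕ) : ℤ)) := by
    have := (padicNorm.dvd_iff_norm_le (p := p) (n := m / p) (z := (N.descFactorial m : ℤ))).1
      (by exact_mod_cast h1)
    exact_mod_cast this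
  rw [padicNorm.mul]
  refine (mul_le_mul h4 (hf m) (padicNorm.nonneg _) (by positivity)).trans_lt ?_
  rw [← zpow_natCast, ← zpow_add₀ (by positivity)]
  refine zpow_lt_one_of_neg₀ hp1 ?_
  have : 1 ≤ m / p := (Nat.one_le_div_iff hp.out.pos).2 hm
  omega

theorem succ_mul_choose_succ (s : ℤ) (k : ℕ) :
    ((k : ℤ) + 1) * Ring.choose s (k + 1) = (s - k) * Ring.choose s k := by
  have h := Ring.choose_smul_choose s (Nat.le_add_right k 1)
  rw [Nat.add_sub_cancel_left, Ring.choose_one_right, Nat.choose_succ_self_right,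
    nsmul_eq_mul] at h
  push_cast at h
  linear_combination h

/-- Terms with j ≤ k - 2 are small since their cofactors have degree at least p. Only j = k - 1 is
delicate, and `h` offers two ways out: a cofactor coefficient divisible by p, or a comparison of
τ_{k-1} with τ_k. -/
theorem padicNorm_sub_tauConst_lt (hodd : Odd p) {n k : ℕ} (s : ℤ)
    {Q : PowerSeries ℚ} (hQ : Q ∈ growthSubring p) (hQ1 : PowerSeries.constantCoeff Q = 1) {S : ℚ}
    (hS : ∀ j ≤ k, padicNorm p (tauConst p n s j) ≤ S)
    (h : ∀ j, k = j + 1 → padicNorm p (PowerSeries.coeff (p - 1) (cofactor p s j * Q)) < 1 ∨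
      (s - j ≠ 0 ∧ padicNorm p (k : ℚ) ≤ padicNorm p ((s - j : ℤ) : ℚ))) :
    padicNorm p ((n.descFactorial (k * (p - 1)) : ℚ) * PowerSeries.coeff (k * (p - 1))
        (((logDiv ^ s : (PowerSeries ℚ)ˣ) : PowerSeries ℚ) * Q) - tauConst p n s k) < S := by
  have h3 : 3 ≤ p := by
    have := hp.out.two_le
    rcases hodd with ⟨a, ha⟩
    omega
  have hp1 : (1 : ℚ) < p := by exact_mod_cast hp.out.one_lt
  -- τ_0 = 1.
  have hS0 : 0 < S := by
    have := hS 0 (Nat.zero_le _)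
    rw [tauConst] at this
    simp only [zero_mul, Nat.descFactorial_zero, Ring.choose_zero_right, pow_zero, Nat.cast_one,
      Int.cast_one, mul_one, div_one, padicNorm.one] at this
    linarith
  have hmem : ∀ j, cofactor p s j * Q ∈ growthSubring p := fun j =>
    mul_mem (cofactor_mem_growthSubring h3 s j) hQ
  rw [descFactorial_mul_coeff_logDiv_zpow_mul hodd, Finset.sum_range_succ]
  have e0 : PowerSeries.coeff 0 (cofactor p s k * Q) = 1 := by
    rw [PowerSeries.coeff_zero_eq_constantCoeff_apply, map_mul, constantCoeff_cofactor, hQ1,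
      one_mul]
  rw [Nat.sub_self, zero_mul, Nat.descFactorial_zero, e0, Nat.cast_one, mul_one, mul_one,
    add_sub_cancel_right]
  refine padicNorm.sum_lt' (fun j hj => ?_) hS0
  have hjk : j < k := Finset.mem_range.1 hj
  rcases Nat.lt_or_ge (j + 1) k with hlt | hge
  · rw [padicNorm.mul]
    have hm : p ≤ (k - j) * (p - 1) :=
      le_trans (by omega) (Nat.mul_le_mul_right (p - 1) (show 2 ≤ k - j by omega))
    refine (mul_le_mul_of_nonneg_right (hS j hjk.le) (padicNorm.nonneg _)).trans_lt ?_
    exact mul_lt_of_lt_one_right hS0 (padicNorm_descFactorial_mul_coeff_lt_one (hmem j) hm _)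
  · obtain rfl : k = j + 1 := by omega
    rw [Nat.add_sub_cancel_left, one_mul]
    have hint : padicNorm p (PowerSeries.coeff (p - 1) (cofactor p s j * Q)) ≤ 1 := by
      have := hmem j (p - 1)
      rwa [Nat.div_eq_of_lt (by omega), Nat.zero_sub, pow_zero] at this
    rcases h j rfl with hlt | ⟨hne, hle⟩
    · rw [padicNorm.mul, padicNorm.mul]
      refine (mul_le_mul_of_nonneg_right (hS j hjk.le)
        (mul_nonneg (padicNorm.nonneg _) (padicNorm.nonneg _))).trans_lt ?_
      refine mul_lt_of_lt_one_right hS0 (lt_of_le_of_lt ?_ hlt)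
      exact mul_le_of_le_one_left (padicNorm.nonneg _) (padicNorm.of_nat _)
    -- From (j+1) C(s,j+1) = (s-j) C(s,j). The extra p on the right supplies the strict inequality
    -- once s - j is no more divisible by p than k = j + 1.
    · have hid : ((s - j : ℤ) : ℚ) * (tauConst p n s j *
            ((n - j * (p - 1)).descFactorial (p - 1) : ℚ)) =
          p * (((j + 1 : ℕ) : ℚ) * tauConst p n s (j + 1)) := by
        have hle2 : j * (p - 1) ≤ (j + 1) * (p - 1) := Nat.mul_le_mul_right _ (Nat.le_succ j)
        have h4 := Nat.descFactorial_mul_descFactorial (n := n) hle2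
        rw [← Nat.sub_mul, Nat.add_sub_cancel_left, one_mul] at h4
        have h5 : ((j : ℚ) + 1) * ((Ring.choose s (j + 1) : ℤ) : ℚ) =
            ((s : ℚ) - j) * ((Ring.choose s j : ℤ) : ℚ) := by
          exact_mod_cast succ_mul_choose_succ s j
        have hp0 : (p : ℚ) ≠ 0 := by positivity
        rw [tauConst, tauConst, ← h4]
        push_cast
        field_simp
        linear_combination (-((n - j * (p - 1)).descFactorial (p - 1) : ℚ) *
          (n.descFactorial (j * (p - 1)) : ℚ) * p * (p : ℚ) ^ j) * h5
      have hpos : 0 < padicNorm p ((s - j : ℤ) : ℚ) :=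
        lt_of_le_of_ne (padicNorm.nonneg _)
          (padicNorm.nonzero (by exact_mod_cast hne)).symm
      have hn := congrArg (padicNorm p) hid
      rw [padicNorm.mul, padicNorm.mul (p : ℚ), padicNorm.mul ((j + 1 : ℕ) : ℚ)] at hn
      rw [← mul_assoc, padicNorm.mul]
      refine (mul_le_of_le_one_right (padicNorm.nonneg _) hint).trans_lt ?_
      refine lt_of_mul_lt_mul_left ?_ hpos.le
      rw [hn]
      calc _ ≤ padicNorm p (p : ℚ) * (padicNorm p ((s - j : ℤ) : ℚ) * S) := by
            refine mul_le_mul_of_nonneg_left ?_ (padicNorm.nonneg _)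
            exact mul_le_mul hle (hS _ le_rfl) (padicNorm.nonneg _) hpos.le
        _ < 1 * (padicNorm p ((s - j : ℤ) : ℚ) * S) :=
            mul_lt_mul_of_pos_right padicNorm.padicNorm_p_lt_one_of_prime (mul_pos hpos hS0)
        _ = _ := one_mul _

/-- The derivative of f^p is p f^(p-1) f', and i + 1 is prime to p. Below degree p all coefficients
involved are p-integral. -/
theorem padicNorm_coeff_pow_prime_lt_one {f : PowerSeries ℚ} (hf : f ∈ growthSubring p)
    {i : ℕ} (hi : i + 1 < p) : padicNorm p (PowerSeries.coeff (i + 1) (f ^ p)) < 1 := by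
  have hsmall : ∀ m < p, ∀ g ∈ growthSubring p, padicNorm p (PowerSeries.coeff m g) ≤ 1 := by
    intro m hm g hg
    have := hg m
    rwa [Nat.div_eq_of_lt hm, Nat.zero_sub, pow_zero] at this
  have hd := congrArg (PowerSeries.coeff i) (Derivation.leibniz_pow (PowerSeries.derivative ℚ) f p)
  rw [PowerSeries.coeff_derivative, nsmul_eq_mul, smul_eq_mul] at hd
  have hc : (p : PowerSeries ℚ) = PowerSeries.C (p : ℚ) := by simp
  rw [hc, PowerSeries.coeff_C_mul] at hd
  have hn := congrArg (padicNorm p) hd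
  have h1 : padicNorm p ((i : ℚ) + 1) = 1 := by
    exact_mod_cast (padicNorm.nat_eq_one_iff (p := p) (i + 1)).2
      (Nat.not_dvd_of_pos_of_lt i.succ_pos hi)
  rw [padicNorm.mul, h1, mul_one, padicNorm.mul] at hn
  rw [hn]
  refine mul_lt_one_of_nonneg_of_lt_one_left (padicNorm.nonneg _)
    padicNorm.padicNorm_p_lt_one_of_prime ?_
  rw [PowerSeries.coeff_mul]
  refine padicNorm.sum_le' (fun x hx => ?_) zero_le_one
  rw [Finset.HasAntidiagonal.mem_antidiagonal] at hx
  rw [PowerSeries.coeff_derivative, padicNorm.mul, padicNorm.mul]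
  refine mul_le_one₀ (hsmall _ (by omega) _ (pow_mem hf _))
    (mul_nonneg (padicNorm.nonneg _) (padicNorm.nonneg _))
    (mul_le_one₀ (hsmall _ (by omega) _ hf) (padicNorm.nonneg _) ?_)
  exact_mod_cast padicNorm.of_nat (p := p) (x.2 + 1)

/-- Modulo z^p the factor E^j is 1, and G^(s-j) is a p-th power. -/
theorem padicNorm_coeff_cofactor_lt_one (h3 : 3 ≤ p) {s : ℤ} {j : ℕ} (h : (p : ℤ) ∣ s - j) :
    padicNorm p (PowerSeries.coeff (p - 1) (cofactor p s j)) < 1 := by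
  obtain ⟨t, ht⟩ := h
  have e1 : PowerSeries.X ^ p ∣ logDivExpand p ^ j - 1 := by
    refine dvd_trans ?_ (by simpa using sub_dvd_pow_sub_pow (logDivExpand p) 1 j)
    rw [PowerSeries.X_pow_dvd_iff]
    intro m hm
    rw [map_sub, PowerSeries.coeff_one, logDivExpand, PowerSeries.coeff_mk]
    rcases Nat.eq_zero_or_pos m with rfl | h0
    · simp
    · rw [if_neg (Nat.not_dvd_of_pos_of_lt h0 hm), if_neg h0.ne', sub_zero]
  obtain ⟨R, hR⟩ := e1
  rw [sub_eq_iff_eq_add] at hR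
  rw [cofactor, hR, add_mul, one_mul, map_add, mul_assoc, PowerSeries.coeff_X_pow_mul',
    if_neg (by omega), zero_add, ht, mul_comm, zpow_mul, zpow_natCast, Units.val_pow_eq_pow_val]
  have := padicNorm_coeff_pow_prime_lt_one
    (zpow_mem_growthSubring (coprimePart_mem_growthSubring p)
      (constantCoeff_coprimePart hp.out) t) (i := p - 2) (by omega)
  rwa [show p - 2 + 1 = p - 1 by omega] at this

end

/-! ### Comparison of the values at 0 and 1 with τ_r. -/

section

variable {p : ℕ} [hp : Fact p.Prime]

theorem nu_eq_coe_iff (a : ℚ) (z : ℤ) :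
    nu p a = ((z : ℤ) : WithTop ℤ) ↔ padicNorm p a = (p : ℚ) ^ (-z) := by
  have hp1 : (1 : ℚ) < p := by exact_mod_cast hp.out.one_lt
  rw [nu]
  split_ifs with h
  · rw [h, padicNorm.zero]
    have : (p : ℚ) ^ (-z) ≠ 0 := by positivity
    exact ⟨fun h => absurd h (by simp), fun h => absurd h.symm this⟩
  · rw [padicNorm.eq_zpow_of_nonzero h, zpow_right_inj₀ (by positivity) hp1.ne', neg_inj,
      WithTop.coe_inj]

theorem hasPole_iff (a : ℚ) (M : ℕ) : HasPole p a M ↔ padicNorm p a = (p : ℚ) ^ M := by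
  rw [HasPole, nu_eq_coe_iff, neg_neg, zpow_natCast]

theorem nu_le_nu_iff (a b : ℚ) : nu p a ≤ nu p b ↔ padicNorm p b ≤ padicNorm p a := by
  have hp1 : (1 : ℚ) < p := by exact_mod_cast hp.out.one_lt
  by_cases hb : b = 0
  · simp [nu, hb, padicNorm.nonneg]
  by_cases ha : a = 0
  · have : 0 < padicNorm p b := lt_of_le_of_ne (padicNorm.nonneg _) (padicNorm.nonzero hb).symm
    rw [nu, nu, if_pos ha, if_neg hb, ha, padicNorm.zero]
    exact iff_of_false (by simp) (not_le.2 this)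
  rw [nu, nu, if_neg ha, if_neg hb, padicNorm.eq_zpow_of_nonzero ha,
    padicNorm.eq_zpow_of_nonzero hb, zpow_le_zpow_iff_right₀ hp1, neg_le_neg_iff,
    WithTop.coe_le_coe]

theorem padicNorm_eq_of_sub_lt {x y c : ℚ} (h : padicNorm p (x - y) < c)
    (hy : padicNorm p y = c) : padicNorm p x = c := by
  have h1 := padicNorm.add_eq_max_of_ne (p := p) (q := x - y) (r := y) (by rw [hy]; exact h.ne)
  rwa [sub_add_cancel, hy, max_eq_right h.le] at h1

theorem padicNorm_eq_iff_of_sub_lt {x y c : ℚ} (h : padicNorm p (x - y) < c) :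
    padicNorm p x = c ↔ padicNorm p y = c := by
  refine ⟨padicNorm_eq_of_sub_lt ?_, padicNorm_eq_of_sub_lt h⟩
  rwa [← padicNorm.neg, neg_sub]

/-- For Q = 1 one of the two alternatives always holds, according to whether p divides s - j; so the
value at 1 needs no condition on l. -/
theorem padicNorm_coeff_cofactor_or (hodd : Odd p) (s : ℤ) (k j : ℕ) :
    padicNorm p (PowerSeries.coeff (p - 1) (cofactor p s j * 1)) < 1 ∨
      (s - j ≠ 0 ∧ padicNorm p (k : ℚ) ≤ padicNorm p ((s - j : ℤ) : ℚ)) := by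
  by_cases h : (p : ℤ) ∣ s - j
  · left
    rw [mul_one]
    refine padicNorm_coeff_cofactor_lt_one ?_ h
    have := hp.out.two_le
    rcases hodd with ⟨a, ha⟩
    omega
  · right
    refine ⟨fun h0 => h (h0 ▸ dvd_zero _), ?_⟩
    rw [(padicNorm.int_eq_one_iff _).2 h]
    exact padicNorm.of_nat k

theorem padicNorm_descFactorial_mul_coeff_sub_tauConst_lt (hodd : Odd p) {n k : ℕ} (s : ℤ) {S : ℚ}
    (hS : ∀ j ≤ k, padicNorm p (tauConst p n s j) ≤ S) :
    padicNorm p ((n.descFactorial (k * (p - 1)) : ℚ) * PowerSeries.coeff (k * (p - 1))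
        ((logDiv ^ s : (PowerSeries ℚ)ˣ) : PowerSeries ℚ) - tauConst p n s k) < S := by
  have := padicNorm_sub_tauConst_lt hodd s (one_mem _) (map_one _) hS
    fun j _ => padicNorm_coeff_cofactor_or hodd s k j
  rwa [mul_one] at this

/-- For k maximizing |τ_k|, the coefficient of (x)_{n-k(p-1)} in B_n^{(l)}(x+1) has norm exactly
|τ_k|, and the maximum pole bounds it. -/
theorem padicNorm_tauConst_le (hodd : Odd p) {n r : ℕ} (hr : n = r * (p - 1)) (l : ℤ) {j : ℕ}
    (hj : j ≤ r) : padicNorm p (tauConst p n (l - n - 1) j) ≤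
      (p : ℚ) ^ maxPole p (hoBernoulli n l) := by
  obtain ⟨k, hk, hmax⟩ := Finset.exists_max_image (Finset.range (r + 1))
    (fun j => padicNorm p (tauConst p n (l - n - 1) j)) ⟨0, by simp⟩
  simp only [Finset.mem_range, Nat.lt_succ_iff] at hk hmax
  refine (hmax j hj).trans ?_
  rw [← padicNorm_eq_of_sub_lt (padicNorm_descFactorial_mul_coeff_sub_tauConst_lt hodd _
    fun i hi => hmax i (hi.trans hk)) rfl]
  exact padicNorm_descFactorial_mul_coeff_le p n l (hr ▸ Nat.mul_le_mul_right _ hk)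

theorem padicNorm_eval_one_sub_lt (hodd : Odd p) {n r : ℕ} (hr : n = r * (p - 1)) (l : ℤ) :
    padicNorm p ((hoBernoulli n l).eval 1 - tauConst p n (l - n - 1) r) <
      (p : ℚ) ^ maxPole p (hoBernoulli n l) := by
  have := padicNorm_descFactorial_mul_coeff_sub_tauConst_lt hodd (l - n - 1)
    fun j (hj : j ≤ r) => padicNorm_tauConst_le hodd hr l hj
  rwa [← hr, Nat.descFactorial_self, ← eval_one_hoBernoulli] at this

theorem padicNorm_eval_zero_sub_lt (hodd : Odd p) {n r : ℕ} (hr : n = r * (p - 1)) (l : ℤ)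
    (hl : nu p (l : ℚ) ≤ nu p (n : ℚ)) :
    padicNorm p ((hoBernoulli n l).eval 0 - tauConst p n (l - n - 1) r) <
      (p : ℚ) ^ maxPole p (hoBernoulli n l) := by
  have hp2 := hp.out.two_le
  have hQ : (1 + PowerSeries.X : PowerSeries ℚ) ∈ growthSubring p := by
    refine add_mem (one_mem _) fun m => ?_
    have h1 : (1 : ℚ) ≤ p := by exact_mod_cast hp.out.one_le
    rw [PowerSeries.coeff_X]
    split_ifs
    · rw [padicNorm.one]; exact one_le_pow₀ h1
    · rw [padicNorm.zero]; positivity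
  have hQ2 := inv_mem_growthSubring hQ (by simp)
  have hQ1 := constantCoeff_zpow_seriesUnit (1 + PowerSeries.X) (by simp) (-1)
  rw [zpow_neg_one] at hQ1
  have := padicNorm_sub_tauConst_lt hodd (l - n - 1) hQ2 hQ1
    (fun j (hj : j ≤ r) => padicNorm_tauConst_le hodd hr l hj) fun j hj => Or.inr ?_
  · rw [← hr, Nat.descFactorial_self] at this
    rwa [eval_zero_hoBernoulli]
  · rw [nu_le_nu_iff] at hl
    have hnr : padicNorm p (n : ℚ) = padicNorm p (r : ℚ) := by
      have h1 : padicNorm p ((p - 1 : ℕ) : ℚ) = 1 :=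
        (padicNorm.nat_eq_one_iff _).2 (Nat.not_dvd_of_pos_of_lt (by omega) (by omega))
      rw [hr, Nat.cast_mul, padicNorm.mul, h1, mul_one]
    have hrpos : 0 < padicNorm p (r : ℚ) :=
      lt_of_le_of_ne (padicNorm.nonneg _)
        (padicNorm.nonzero (by rw [hj]; exact_mod_cast j.succ_ne_zero)).symm
    -- With j = r - 1 and n = r(p-1), s - j = l - rp. As ν(l) ≤ ν(n) = ν(r) < ν(rp), it has the
    -- valuation of l.
    have e : l - n - 1 - j = l + -(r * p : ℕ) := by
      have h2 : n + (j + 1) = r * p := by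
        rw [hr, ← hj, ← Nat.mul_succ, Nat.succ_eq_add_one, Nat.sub_add_cancel (by omega)]
      have h3 : (n : ℤ) + (j + 1) = ((r * p : ℕ) : ℤ) := by exact_mod_cast h2
      linarith
    have hlt : padicNorm p (-((r * p : ℕ) : ℚ)) < padicNorm p (l : ℚ) := by
      rw [padicNorm.neg, Nat.cast_mul, padicNorm.mul]
      refine lt_of_lt_of_le ?_ (hnr ▸ hl)
      exact mul_lt_of_lt_one_right hrpos padicNorm.padicNorm_p_lt_one_of_prime
    have hnorm : padicNorm p ((l - n - 1 - j : ℤ) : ℚ) = padicNorm p (l : ℚ) := by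
      rw [e]
      push_cast at hlt ⊢
      rw [padicNorm.add_eq_max_of_ne hlt.ne', max_eq_left hlt.le]
    have hle : padicNorm p (r : ℚ) ≤ padicNorm p ((l - n - 1 - j : ℤ) : ℚ) := by
      rw [hnorm, ← hnr]; exact hl
    refine ⟨fun h0 => ?_, hle⟩
    rw [h0, Int.cast_zero, padicNorm.zero] at hle
    exact absurd hle (not_le.2 hrpos)

theorem tauPart_eq_tauConst {n r : ℕ} (s : ℤ) {u : ℕ+ →₀ ℕ}
    (hu : ∀ i : ℕ+, u i = if (i : ℕ) = p - 1 then r else 0) :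
    tauPart n s u = tauConst p n s r := by
  have hp2 := hp.out.two_le
  obtain ⟨e, he⟩ : ∃ e : ℕ+, (e : ℕ) = p - 1 := ⟨⟨p - 1, by omega⟩, rfl⟩
  have hu' : u = Finsupp.single e r := by
    ext i
    rw [hu, Finsupp.single_apply, ← he]
    refine if_congr ?_ rfl rfl
    rw [eq_comm, PNat.coe_inj]
  have hc : ((p - 1 : ℕ) : ℚ) + 1 = p := by
    exact_mod_cast Nat.sub_add_cancel hp.out.one_le
  have hm : u.multinomial = 1 := by
    rw [hu', Finsupp.multinomial_eq]
    rcases Nat.eq_zero_or_pos r with rfl | h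
    · simp
    · rw [Finsupp.support_single _ h.ne', Nat.multinomial_singleton]
  rw [tauPart, tPart, hm, partWeight, partLength, hu', Finsupp.sum_single_index (by simp),
    Finsupp.sum_single_index rfl, Finsupp.prod_single_index (by simp), he, hc,
    tauConst, mul_comm (p - 1) r]
  push_cast
  ring

/-- Here τ_r = n! C(s,r)/p^r, and Legendre's formula gives ν(n!) = r - σ_p(n)/(p-1). -/
theorem hasPole_tauConst_iff (hodd : Odd p) {n r : ℕ} (hr : n = r * (p - 1)) (s : ℤ) (M : ℕ) :
    HasPole p (tauConst p n s r) M ↔ nu p ((Ring.choose s r : ℤ) : ℚ) =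
      ((((digitSum p n / (p - 1) : ℕ) : ℤ) - (M : ℤ) : ℤ) : WithTop ℤ) := by
  have h3 : 3 ≤ p := by
    have := hp.out.two_le
    rcases hodd with ⟨a, ha⟩
    omega
  obtain ⟨q, hq⟩ := sub_one_dvd_digitSum h3 (hr ▸ Dvd.intro_left r rfl : p - 1 ∣ n)
  have hqr : q + padicValNat p n ! = r := by
    have h1 := sub_one_mul_padicValNat_factorial (p := p) n
    have h2 := Nat.digit_sum_le p n
    rw [← digitSum] at h1 h2
    have h4 : (p - 1) * (q + padicValNat p n !) = (p - 1) * r := by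
      rw [mul_add, h1, ← hq, mul_comm (p - 1) r, ← hr]
      omega
    exact Nat.eq_of_mul_eq_mul_left (by omega) h4
  have hp0 : (p : ℚ) ≠ 0 := by exact_mod_cast hp.out.ne_zero
  have hfac : padicNorm p (n ! : ℚ) = (p : ℚ) ^ (-(padicValNat p n ! : ℤ)) := by
    have := padicNorm.eq_zpow_of_nonzero (p := p) (q := ((n ! : ℕ) : ℚ))
      (by exact_mod_cast n.factorial_ne_zero)
    rwa [padicValRat.of_nat] at this
  have hpow : padicNorm p ((p : ℚ) ^ r) = (p : ℚ) ^ (-(r : ℤ)) := by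
    have : ∀ r : ℕ, padicNorm p ((p : ℚ) ^ r) = (p : ℚ)⁻¹ ^ r := fun r => by
      induction r with
      | zero => simp
      | succ r ih => rw [pow_succ, padicNorm.mul, ih, padicNorm.padicNorm_p_of_prime, pow_succ]
    rw [this, zpow_neg, zpow_natCast, inv_pow]
  have key : padicNorm p (tauConst p n s r) =
      (p : ℚ) ^ (q : ℤ) * padicNorm p ((Ring.choose s r : ℤ) : ℚ) := by
    rw [tauConst, ← hr, Nat.descFactorial_self, padicNorm.div, padicNorm.mul, hfac, hpow, ← hqr,
      mul_comm, mul_div_assoc, ← zpow_sub₀ hp0, mul_comm]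
    congr 2
    push_cast
    ring
  rw [hasPole_iff, nu_eq_coe_iff, hq, Nat.mul_div_cancel_left _ (by omega), key, neg_sub,
    zpow_sub₀ hp0, zpow_natCast (p : ℚ) M, eq_div_iff (by positivity), mul_comm]

theorem isSAMPC_sub_one_iff (hodd : Odd p) {n r : ℕ} (hr : n = r * (p - 1)) (l : ℤ) :
    IsSAMPC p n (l - 1) ↔
      HasPole p (tauConst p n (l - n - 1) r) (maxPole p (hoBernoulli n l)) := by
  rw [IsSAMPC, sub_add_cancel, maxPole_comp_X_add_one, hasPole_iff, hasPole_iff]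
  exact padicNorm_eq_iff_of_sub_lt (padicNorm_eval_one_sub_lt hodd hr l)

theorem isAMPC_iff (hodd : Odd p) {n r : ℕ} (hr : n = r * (p - 1)) (l : ℤ)
    (hl : nu p (l : ℚ) ≤ nu p (n : ℚ)) :
    IsAMPC p n l ↔ HasPole p (tauConst p n (l - n - 1) r) (maxPole p (hoBernoulli n l)) := by
  rw [IsAMPC, hasPole_iff, hasPole_iff]
  exact padicNorm_eq_iff_of_sub_lt (padicNorm_eval_zero_sub_lt hodd hr l hl)

theorem isAMPC_equivalences (hodd : Odd p) {n r : ℕ} (hr : n = r * (p - 1)) (l : ℤ) (M : ℕ)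
    (hM : M = maxPole p (hoBernoulli n l)) {u : ℕ+ →₀ ℕ}
    (hu : ∀ i : ℕ+, u i = if (i : ℕ) = p - 1 then r else 0)
    (hl : nu p (l : ℚ) ≤ nu p (n : ℚ)) :
    (IsAMPC p n l ↔
      (HasPole p (tauPart n (l - n - 1) u) M ∧ HasPole p ((hoBernoulli n l).eval 0) M)) ∧
    (IsAMPC p n l ↔
      nu p ((Ring.choose (l - n - 1) r : ℤ) : ℚ) =
        ((((digitSum p n / (p - 1) : ℕ) : ℤ) - (M : ℤ) : ℤ) : WithTop ℤ)) ∧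
    (IsSAMPC p n (l - 1) ↔ IsAMPC p n l) ∧
    (IsSAMPC p n (l - 1) ∨ IsAMPC p n l →
      nu p ((hoBernoulli n l).eval 0) = nu p ((hoBernoulli n l).eval 1)) := by
  have hA := isAMPC_iff hodd hr l hl
  have hB := isSAMPC_sub_one_iff hodd hr l
  rw [tauPart_eq_tauConst _ hu, ← hasPole_tauConst_iff hodd hr, hM]
  refine ⟨⟨fun h => ⟨hA.1 h, h⟩, fun h => h.2⟩, hA, hB.trans hA.symm, fun h => ?_⟩
  have h0 : IsAMPC p n l := h.elim (fun h => hA.2 (hB.1 h)) id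
  have h1 : IsSAMPC p n (l - 1) := hB.2 (hA.1 h0)
  rw [IsSAMPC, sub_add_cancel, maxPole_comp_X_add_one] at h1
  exact Eq.trans h0 h1.symm

/-- The hypothesis forces p ∣ l, so l + 1 is prime to p. -/
theorem nu_add_one_le_of_lt {n : ℕ} {l : ℤ} (h : nu p (n : ℚ) < nu p (l : ℚ)) :
    nu p ((l + 1 : ℤ) : ℚ) ≤ nu p (n : ℚ) := by
  have h1 : padicNorm p (l : ℚ) < padicNorm p (n : ℚ) := by
    rwa [← not_le, nu_le_nu_iff, not_le] at h
  have h2 : (p : ℤ) ∣ l :=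
    (padicNorm.int_lt_one_iff l).1 (h1.trans_le (padicNorm.of_nat n))
  have h3 : ¬ (p : ℤ) ∣ l + 1 := fun h3 => by
    have h4 : (p : ℤ) ∣ 1 := (dvd_add_right h2).1 h3
    exact hp.out.one_lt.ne' (by exact_mod_cast Int.eq_one_of_dvd_one (by positivity) h4)
  rw [nu_le_nu_iff, (padicNorm.int_eq_one_iff _).2 h3]
  exact padicNorm.of_nat n

end

theorem mainTheorem5 (p : ℕ) (hp : p.Prime) (hodd : Odd p) (n r : ℕ) (hr : n = r * (p - 1))
    (l : ℤ) (M M' : ℕ) (hM : M = maxPole p (hoBernoulli n l))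
    (hM' : M' = maxPole p (hoBernoulli n (l + 1)))
    (u : ℕ+ →₀ ℕ) (hu : ∀ i : ℕ+, u i = if (i : ℕ) = p - 1 then r else 0) :
    -- (a)
    ((IsSAMPC p n (l - 1) ↔
        nu p ((Ring.choose (l - n - 1) r : ℤ) : ℚ) =
          ((((digitSum p n / (p - 1) : ℕ) : ℤ) - (M : ℤ) : ℤ) : WithTop ℤ)) ∧
      (IsSAMPC p n (l - 1) ↔
        (HasPole p (tauPart n (l - n - 1) u) M ∧ HasPole p ((hoBernoulli n l).eval 1) M))) ∧
    -- (b)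
    (nu p (l : ℚ) ≤ nu p (n : ℚ) →
      (IsAMPC p n l ↔
        (HasPole p (tauPart n (l - n - 1) u) M ∧ HasPole p ((hoBernoulli n l).eval 0) M)) ∧
      (IsAMPC p n l ↔
        nu p ((Ring.choose (l - n - 1) r : ℤ) : ℚ) =
          ((((digitSum p n / (p - 1) : ℕ) : ℤ) - (M : ℤ) : ℤ) : WithTop ℤ)) ∧
      (IsSAMPC p n (l - 1) ↔ IsAMPC p n l) ∧
      (IsSAMPC p n (l - 1) ∨ IsAMPC p n l →
        nu p ((hoBernoulli n l).eval 0) = nu p ((hoBernoulli n l).eval 1))) ∧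
    -- (c)
    (nu p (n : ℚ) < nu p (l : ℚ) →
      nu p ((l + 1 : ℤ) : ℚ) ≤ nu p (n : ℚ) ∧
      (IsAMPC p n (l + 1) ↔
        (HasPole p (tauPart n (l + 1 - n - 1) u) M' ∧
          HasPole p ((hoBernoulli n (l + 1)).eval 0) M')) ∧
      (IsAMPC p n (l + 1) ↔
        nu p ((Ring.choose (l + 1 - n - 1) r : ℤ) : ℚ) =
          ((((digitSum p n / (p - 1) : ℕ) : ℤ) - (M' : ℤ) : ℤ) : WithTop ℤ)) ∧
      (IsSAMPC p n l ↔ IsAMPC p n (l + 1)) ∧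
      (IsSAMPC p n l ∨ IsAMPC p n (l + 1) →
        nu p ((hoBernoulli n (l + 1)).eval 0) = nu p ((hoBernoulli n (l + 1)).eval 1))) := by
  have : Fact p.Prime := ⟨hp⟩
  refine ⟨⟨?_, ?_⟩, isAMPC_equivalences hodd hr l M hM hu, fun h => ?_⟩
  · rw [hM, ← hasPole_tauConst_iff hodd hr]
    exact isSAMPC_sub_one_iff hodd hr l
  · rw [tauPart_eq_tauConst _ hu, hM]
    refine ⟨fun h => ⟨(isSAMPC_sub_one_iff hodd hr l).1 h, ?_⟩,
      fun h => (isSAMPC_sub_one_iff hodd hr l).2 h.1⟩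
    rwa [IsSAMPC, sub_add_cancel, maxPole_comp_X_add_one] at h
  · have h1 := nu_add_one_le_of_lt h
    have h2 := isAMPC_equivalences hodd hr (l + 1) M' hM' hu h1
    rw [add_sub_cancel_right l 1] at h2
    exact ⟨h1, h2⟩
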